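/- Let $0<T<\infty$, let $\Lambda\subset\mathbb R$ and $\Omega\subset\mathbb R^n$ be open and let $F:\Lambda\times\Omega\times[0,T]\to\mathbb R^n$. Let $\mathbb R^n$ carry the norm $\|x\|_n=\sum_j|x_j|$ and let the space $\mathcal L(\mathbb R^n)$ of real $n\times n$ matrices carry the norm $\|A\|_{n\times n}=\max_i\sum_j|a_{ij}|$. Let $G[0,T]$ be the Banach space of regulated functions $[0,T]\to\mathbb R^n$ (those having a left limit at every point of $(0,T]$ and a right limit at every point of $[0,T)$) with the supremum norm $\|\cdot\|_\infty$, and let $B(x_0,\rho)$ be its closed ball with centre $x_0$ and radius $\rho$. For $U:[0,s]\times[0,s]\to\mathbb R^n$, $\int_0^sDU(\tau,t)$ denotes the Kurzweil integral: the $I\in\mathbb R^n$ such that for every $\varepsilon>0$ there is $\delta:[0,s]\to(0,\infty)$ with $\big\|\sum_j[U(\tau_j,t_j)-U(\tau_j,t_{j-1})]-I\big\|_n<\varepsilon$ for all $0=t_0\le t_1\le\dots\le t_\nu=s$ and $\tau_j\in[t_{j-1},t_j]\subset(\tau_j-\delta(\tau_j),\tau_j+\delta(\tau_j))$. For $X=\mathbb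 R^n$ or $X=\mathcal L(\mathbb R^n)$, a nondecreasing $h:[0,T]\to\mathbb R$ and an increasing continuous $\omega:[0,\infty)\to[0,\infty)$ with $\omega(0)=0$, let $\mathcal F(h,\omega;X)$ be the set of all $H:\Omega\times[0,T]\to X$ such that, for all $x,y\in\Omega$ and $t,s\in[0,T]$, $$\|H(x,t)-H(x,s)\|_X\le|h(t)-h(s)|,\qquad \|H(x,t)-H(x,s)-H(y,t)+H(y,s)\|_X\le\omega(\|x-y\|_n)\,|h(t)-h(s)|.$$ Assume: 1. there are $h,\omega$ as above such that $F(\lambda,\cdot,\cdot)\in\mathcal F(h,\omega;\mathbb R^n)$ for all $\lambda\in\Lambda$; 2. $x_0\in G[0,T]$ satisfies, for every $\lambda\in\Lambda$, $x_0(0)=x_0(T)$, $x_0(s)\in\Omega$ and $x_0(s)=x_0(0)+\int_0^sDF(\lambda,x_0(\tau),t)$ for $s\in[0,T]$; and $\rho>0$ is such that $x(t)\in\Omega$ for all $x\in B(x_0,\rho)$ and $t\in[0,T]$; 3. there is a nondecreasing $\gamma:[0,T]\to\mathbb R$ such that for every $\varepsilon>0$ there is $\delta>0$ with $$\|F(\lambda_1,x,t)-F(\lambda_2,x,t)-F(\lambda_1,x,s)+F(\lambda_2,x,s)\|_n\le\varepsilon\,|\gamma(t)-\gamma(s)|$$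 for all $x\in\Omega$, $t,s\in[0,T]$ and $\lambda_1,\lambda_2\in\Lambda$ with $|\lambda_1-\lambda_2|<\delta$; 4. for every $(\lambda,x,t)\in\Lambda\times\Omega\times[0,T]$ the function $F(\lambda,\cdot,t)$ has a derivative $F'_x(\lambda,x,t)\in\mathcal L(\mathbb R^n)$ at $x$, which is continuous in $x\in\Omega$ for fixed $(\lambda,t)$, and there are a nondecreasing $\widetilde h:[0,T]\to[0,\infty)$ and an increasing continuous $\widetilde\omega:[0,\infty)\to[0,\infty)$ with $\widetilde\omega(0)=0$ such that $F'_x(\lambda,\cdot,\cdot)\in\mathcal F(\widetilde h,\widetilde\omega;\mathcal L(\mathbb R^n))$ for all $\lambda\in\Lambda$; 5. condition 3 holds with $F'_x$ in place of $F$, the norm $\|\cdot\|_{n\times n}$ in place of $\|\cdot\|_n$, and some nondecreasing $\widetilde\gamma$ in place of $\gamma$. For $\lambda\in\Lambda$ and $x\in B(x_0,\rho)$ put $\Phi(\lambda,x)(s)=x(T)+\int_0^sDF(\lambda,x(\tau),t)$, $s\in[0,T]$. Let $\lambda_0\in\Lambda$ and suppose that $(x_0,\lambda_0)$ is a bifurcation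 point of the equation $x=\Phi(\lambda,x)$, that is, $(x_0,\lambda_0)$ is a solution of it and every neighbourhood of $(x_0,\lambda_0)$ in $B(x_0,\rho)\times\Lambda$ contains a solution $(x,\lambda)$ with $x\neq x_0$. Then there is $q\in G[0,T]$ such that the equation $$z(s)-z(T)-\int_0^sD[F'_x(\lambda_0,x_0(\tau),t)\,z(\tau)]=q(s)\quad\text{for } s\in[0,T]$$ has no solution $z\in G[0,T]$, and the corresponding homogeneous equation (with $q=0$) has at least one nontrivial solution $z\in G[0,T]$. -/

import Mathlib

open Set Filter Topology

attribute [local instance] Matrix.linftyOpNormedAddCommGroup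

/-- `ℝⁿ` with the norm `‖x‖ = ∑ j, |x j|`. Square matrices carry the maximal absolute row sum as
their norm (the local instance above). -/
abbrev Rn (n : ℕ) : Type := PiLp 1 (fun _ : Fin n => ℝ)

/-- The linear operator on `ℝⁿ` represented by a matrix. -/
noncomputable def matCLM {n : ℕ} (A : Matrix (Fin n) (Fin n) ℝ) : Rn n →L[ℝ] Rn n :=
  LinearMap.toContinuousLinearMap (Matrix.toLpLin 1 1 A)

/-! ### Regulated functions

A function on `[a, b]` is represented by a function on `ℝ` of which only the values on `[a, b]`
matter. -/

/-- The set `G([a, b]; X)` of regulated functions. -/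
def regulated (a b : ℝ) (X : Type*) [TopologicalSpace X] : Set (ℝ → X) :=
  {x | (∀ t ∈ Ioc a b, ∃ l, Tendsto x (𝓝[<] t) (𝓝 l)) ∧
       (∀ t ∈ Ico a b, ∃ l, Tendsto x (𝓝[>] t) (𝓝 l))}

/-- The supremum norm on `[0, T]` (regulated functions are bounded). -/
noncomputable def supNorm {X : Type*} [Norm X] (T : ℝ) (x : ℝ → X) : ℝ :=
  ⨆ t : Icc (0 : ℝ) T, ‖x t‖

/-- The closed ball `B(x₀, ρ)` in `G([0, T]; X)`. -/
def regBall {X : Type*} [NormedAddCommGroup X] (T : ℝ) (x₀ : ℝ → X) (ρ : ℝ) : Set (ℝ → X) :=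
  {x | x ∈ regulated 0 T X ∧ supNorm T (fun t => x t - x₀ t) ≤ ρ}

/-! ### The Kurzweil integral -/

/-- A tagged partition `a = t₀ ≤ t₁ ≤ ⋯ ≤ t_ν = b` with tags `tag j ∈ [t_j, t_{j+1}]`, `j < ν`. -/
structure TaggedPart (a b : ℝ) where
  ν : ℕ
  pt : ℕ → ℝ
  tag : ℕ → ℝ
  pt_zero : pt 0 = a
  pt_last : pt ν = b
  pt_le : ∀ j < ν, pt j ≤ pt (j + 1)
  tag_mem : ∀ j < ν, tag j ∈ Icc (pt j) (pt (j + 1))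

/-- `P` is `δ`-fine. -/
def TaggedPart.IsFine {a b : ℝ} (P : TaggedPart a b) (δ : ℝ → ℝ) : Prop :=
  ∀ j < P.ν, Icc (P.pt j) (P.pt (j + 1)) ⊆
    Ioo (P.tag j - δ (P.tag j)) (P.tag j + δ (P.tag j))

/-- The sum `∑ j, [U(τ_j, t_j) - U(τ_j, t_{j-1})]`. -/
noncomputable def TaggedPart.kSum {X : Type*} [AddCommGroup X] {a b : ℝ} (P : TaggedPart a b)
    (U : ℝ → ℝ → X) : X :=
  ∑ j ∈ Finset.range P.ν, (U (P.tag j) (P.pt (j + 1)) - U (P.tag j) (P.pt j))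

/-- `I` is the Kurzweil integral of `U = U(τ, t)` over `[a, b]`, where `a ≤ b`
(for `a = b` all the sums are `0`, so `I = 0`). -/
def HasKurzweilIntegral {X : Type*} [NormedAddCommGroup X] (U : ℝ → ℝ → X) (a b : ℝ) (I : X) :
    Prop :=
  ∀ ε > 0, ∃ δ : ℝ → ℝ, (∀ s ∈ Icc a b, 0 < δ s) ∧
    ∀ P : TaggedPart a b, P.IsFine δ → ‖P.kSum U - I‖ < ε

/-- `U` is Kurzweil integrable over `[a, b]`. -/
def KurzweilIntegrable {X : Type*} [NormedAddCommGroup X] (U : ℝ → ℝ → X) (a b : ℝ) : Prop :=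
  ∃ I, HasKurzweilIntegral U a b I

open Classical in
/-- The value `∫_a^b DU(τ, t)`, for `a ≤ b`. -/
noncomputable def kurzweilIntegral {X : Type*} [NormedAddCommGroup X] (U : ℝ → ℝ → X) (a b : ℝ) :
    X :=
  if h : KurzweilIntegrable U a b then Classical.choose h else 0

/-! ### The class of right-hand sides -/

/-- `ω : [0, ∞) → [0, ∞)` is increasing and continuous with `ω(0) = 0`. -/
def IsModulus (ω : ℝ → ℝ) : Prop :=
  StrictMonoOn ω (Ici 0) ∧ ContinuousOn ω (Ici 0) ∧ ω 0 = 0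

/-- The class `𝓕(Ω × [a, b], h, ω; X)`. -/
def classF {E X : Type*} [NormedAddCommGroup E] [NormedAddCommGroup X] (Ω : Set E) (a b : ℝ)
    (h ω : ℝ → ℝ) : Set (E → ℝ → X) :=
  {F | (∀ x ∈ Ω, ∀ t₁ ∈ Icc a b, ∀ t₂ ∈ Icc a b, ‖F x t₂ - F x t₁‖ ≤ |h t₂ - h t₁|) ∧
       (∀ x ∈ Ω, ∀ y ∈ Ω, ∀ t₁ ∈ Icc a b, ∀ t₂ ∈ Icc a b,
         ‖F x t₂ - F x t₁ - F y t₂ + F y t₁‖ ≤ ω ‖x - y‖ * |h t₂ - h t₁|)}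

/-- `F(λ, ·, ·) ∈ 𝓕(Ω × [0, T], h, ω)` for all `λ ∈ Λ`, with `h`, `ω` independent of `λ`. -/
def FieldCondition {n : ℕ} (Λ : Set ℝ) (Ω : Set (Rn n)) (T : ℝ) (F : ℝ → Rn n → ℝ → Rn n) :
    Prop :=
  ∃ h ω : ℝ → ℝ, MonotoneOn h (Icc 0 T) ∧ IsModulus ω ∧ ∀ lam ∈ Λ, F lam ∈ classF Ω 0 T h ω

/-- `DF(λ, x, t)` is the (matrix of the) derivative of `F(λ, ·, t)` at `x`, it is continuous in `x`
and `DF(λ, ·, ·) ∈ 𝓕(Ω × [0, T], h, ω; 𝓛(ℝⁿ))` for all `λ ∈ Λ`, with `h`, `ω` independent of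
`λ`. -/
def DerivCondition {n : ℕ} (Λ : Set ℝ) (Ω : Set (Rn n)) (T : ℝ) (F : ℝ → Rn n → ℝ → Rn n)
    (DF : ℝ → Rn n → ℝ → Matrix (Fin n) (Fin n) ℝ) : Prop :=
  (∀ lam ∈ Λ, ∀ x ∈ Ω, ∀ t ∈ Icc 0 T,
    HasFDerivAt (fun y => F lam y t) (matCLM (DF lam x t)) x) ∧
  (∀ lam ∈ Λ, ∀ t ∈ Icc 0 T, ContinuousOn (fun x => DF lam x t) Ω) ∧
  ∃ h ω : ℝ → ℝ, MonotoneOn h (Icc 0 T) ∧ (∀ t ∈ Icc 0 T, 0 ≤ h t) ∧ IsModulus ω ∧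
    ∀ lam ∈ Λ, DF lam ∈ classF Ω 0 T h ω

/-- Continuous dependence on the parameter: there is a nondecreasing `γ` such that for every
`ε > 0` there is `δ > 0` with
`‖F(λ₁,x,t) - F(λ₂,x,t) - F(λ₁,x,s) + F(λ₂,x,s)‖ ≤ ε |γ(t) - γ(s)|` whenever
`|λ₁ - λ₂| < δ`. -/
def ParamCondition {E X : Type*} [NormedAddCommGroup X] (Λ : Set ℝ) (Ω : Set E) (T : ℝ)
    (F : ℝ → E → ℝ → X) : Prop :=
  ∃ γ : ℝ → ℝ, MonotoneOn γ (Icc 0 T) ∧ ∀ ε > 0, ∃ δ > 0,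
    ∀ x ∈ Ω, ∀ t ∈ Icc 0 T, ∀ s ∈ Icc 0 T, ∀ lam₁ ∈ Λ, ∀ lam₂ ∈ Λ, |lam₁ - lam₂| < δ →
      ‖F lam₁ x t - F lam₂ x t - F lam₁ x s + F lam₂ x s‖ ≤ ε * |γ t - γ s|

/-! ### The periodic problem, the operator `Φ` and bifurcation points -/

/-- `(x, λ)` solves the periodic problem `dx/dτ = DF(λ, x, t)`, `x(0) = x(T)`. -/
def IsPeriodicSolution {n : ℕ} (Λ : Set ℝ) (Ω : Set (Rn n)) (T : ℝ) (F : ℝ → Rn n → ℝ → Rn n)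
    (x : ℝ → Rn n) (lam : ℝ) : Prop :=
  x ∈ regulated 0 T (Rn n) ∧ lam ∈ Λ ∧
  (∀ s ∈ Icc 0 T, x s ∈ Ω ∧ KurzweilIntegrable (fun τ t => F lam (x τ) t) 0 s ∧
    x s = x 0 + kurzweilIntegral (fun τ t => F lam (x τ) t) 0 s) ∧
  x 0 = x T

/-- `Φ(λ, x)(s) = x(T) + ∫_0^s DF(λ, x(τ), t)`. -/
noncomputable def Phi {n : ℕ} (T : ℝ) (F : ℝ → Rn n → ℝ → Rn n) (lam : ℝ) (x : ℝ → Rn n) (s : ℝ) :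
    Rn n :=
  x T + kurzweilIntegral (fun τ t => F lam (x τ) t) 0 s

/-- `(x, λ) ∈ B(x₀, ρ) × Λ` solves `x = Φ(λ, x)` (the integrals in `Φ(λ, x)` exist). -/
def IsOperatorSolution {n : ℕ} (Λ : Set ℝ) (T : ℝ) (F : ℝ → Rn n → ℝ → Rn n) (x₀ : ℝ → Rn n)
    (ρ : ℝ) (x : ℝ → Rn n) (lam : ℝ) : Prop :=
  x ∈ regBall T x₀ ρ ∧ lam ∈ Λ ∧
  ∀ s ∈ Icc 0 T, KurzweilIntegrable (fun τ t => F lam (x τ) t) 0 s ∧ x s = Phi T F lam x s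

/-- `(x₀, λ₀)` is a bifurcation point of `x = Φ(λ, x)`: it is a solution and every neighbourhood of
it in `B(x₀, ρ) × Λ` contains a solution `(x, λ)` with `x ≠ x₀`. -/
def IsBifurcationPoint {n : ℕ} (Λ : Set ℝ) (T : ℝ) (F : ℝ → Rn n → ℝ → Rn n) (ρ : ℝ)
    (x₀ : ℝ → Rn n) (lam₀ : ℝ) : Prop :=
  IsOperatorSolution Λ T F x₀ ρ x₀ lam₀ ∧
  ∀ ε > 0, ∃ (x : ℝ → Rn n) (lam : ℝ), IsOperatorSolution Λ T F x₀ ρ x lam ∧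
    supNorm T (fun t => x t - x₀ t) < ε ∧ |lam - lam₀| < ε ∧ ∃ t ∈ Icc 0 T, x t ≠ x₀ t

/-- `z ∈ G[0, T]` solves `z(s) - z(T) - ∫_0^s D[A(x₀(τ), t) z(τ)] = q(s)` for `s ∈ [0, T]`. -/
def IsLinearSolution {n : ℕ} (T : ℝ) (A : Rn n → ℝ → Matrix (Fin n) (Fin n) ℝ) (x₀ : ℝ → Rn n)
    (q z : ℝ → Rn n) : Prop :=
  z ∈ regulated 0 T (Rn n) ∧
  ∀ s ∈ Icc 0 T, KurzweilIntegrable (fun τ t => matCLM (A (x₀ τ) t) (z τ)) 0 s ∧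
    z s - z T - kurzweilIntegral (fun τ t => matCLM (A (x₀ τ) t) (z τ)) 0 s = q s

/-!
At solutions `(x, λ)` near `(x₀, λ₀)` with `x ≠ x₀`, the rescaled difference `(x - x₀) / ‖x - x₀‖`
equals its value at `T` plus an integral whose integrand has increments dominated by those of one
fixed monotone function. By a Helly type compactness argument such differences converge uniformly
along an ultrafilter, and by the mean value inequality their limit, which has norm at least `1 / 2`,
solves the homogeneous linearized equation.

The linearized operator is a compact perturbation of the identity. If it were onto, iterated
preimages of a kernel element would span a strictly increasing sequence of finite-dimensional
subspaces, and Riesz's lemma would contradict compactness. The argument needs only the linear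
relation of pairs `(z, q)` of a solution and its right-hand side, so that the integral need not
exist for every regulated `z`.
-/

/-! ### Dominated increments -/

section Increments

variable {α X : Type*} [Preorder α] [SeminormedAddCommGroup X] {f f' : α → X} {g g' : α → ℝ}
  {s s' : Set α}

/-- The increments of `f` on `s` are dominated by those of the real function `g`, which is then
nondecreasing on `s`. Both bounds defining the class `𝓕(h, ω)` are of this form, and so is the
bound which an integrand passes on to its indefinite Kurzweil integral. -/
def IncrementsLE (f : α → X) (g : α → ℝ) (s : Set α) : Prop :=
  ∀ ⦃r⦄, r ∈ s → ∀ ⦃t⦄, t ∈ s → r ≤ t → ‖f t - f r‖ ≤ g t - g r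

namespace IncrementsLE

theorem mono (hf : IncrementsLE f g s) (hs : s' ⊆ s) : IncrementsLE f g s' :=
  fun _ hr _ ht => hf (hs hr) (hs ht)

theorem monotoneOn (hf : IncrementsLE f g s) : MonotoneOn g s :=
  fun _ hr _ ht hrt => sub_nonneg.1 ((norm_nonneg _).trans (hf hr ht hrt))

theorem add (hf : IncrementsLE f g s) (hf' : IncrementsLE f' g' s) :
    IncrementsLE (fun t => f t + f' t) (fun t => g t + g' t) s := fun r hr t ht hrt =>
  calc ‖f t + f' t - (f r + f' r)‖ = ‖(f t - f r) + (f' t - f' r)‖ := by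
        rw [add_sub_add_comm]
    _ ≤ (g t - g r) + (g' t - g' r) := norm_add_le_of_le (hf hr ht hrt) (hf' hr ht hrt)
    _ = g t + g' t - (g r + g' r) := by ring

theorem sub_const (hf : IncrementsLE f g s) (c : X) : IncrementsLE (fun t => f t - c) g s :=
  fun r hr t ht hrt => by simpa only [sub_sub_sub_cancel_right] using hf hr ht hrt

theorem const_mul_mono {c c' : ℝ} (hf : IncrementsLE f (fun t => c * g t) s)
    (hg : MonotoneOn g s) (hc : c ≤ c') : IncrementsLE f (fun t => c' * g t) s :=
  fun r hr t ht hrt => (hf hr ht hrt).trans (by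
    rw [← mul_sub, ← mul_sub]
    exact mul_le_mul_of_nonneg_right hc (sub_nonneg.2 (hg hr ht hrt)))

theorem clm_apply {𝕜 E : Type*} [NontriviallyNormedField 𝕜] [SeminormedAddCommGroup E]
    [NormedSpace 𝕜 E] [NormedSpace 𝕜 X] {L : α → E →L[𝕜] X} {C : ℝ} {v : E}
    (hL : IncrementsLE L g s) (hv : ‖v‖ ≤ C) :
    IncrementsLE (fun t => L t v) (fun t => C * g t) s := fun r hr t ht hrt =>
  calc ‖L t v - L r v‖ = ‖(L t - L r) v‖ := rfl
    _ ≤ (g t - g r) * C :=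
      (L t - L r).le_of_opNorm_le_of_le (hL hr ht hrt) hv
    _ = C * g t - C * g r := by ring

end IncrementsLE

theorem incrementsLE_const_mul_of_le_abs {C : ℝ} (hg : MonotoneOn g s)
    (hf : ∀ r ∈ s, ∀ t ∈ s, ‖f t - f r‖ ≤ C * |g t - g r|) :
    IncrementsLE f (fun t => C * g t) s := fun r hr t ht hrt => by
  rw [← mul_sub, ← abs_of_nonneg (sub_nonneg.2 (hg hr ht hrt))]
  exact hf r hr t ht

end Increments

section IncrementsLimits

variable {α X : Type*} [LinearOrder α] [SeminormedAddCommGroup X] {f : α → X} {g : α → ℝ}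
  {s : Set α}

theorem IncrementsLE.norm_sub_le_dist {r t : α} (hf : IncrementsLE f g s) (hr : r ∈ s)
    (ht : t ∈ s) : ‖f r - f t‖ ≤ dist (g r) (g t) := by
  rcases le_total r t with h | h
  · rw [norm_sub_rev, dist_comm]
    exact (hf hr ht h).trans (le_abs_self _)
  · exact (hf ht hr h).trans (le_abs_self _)

theorem IncrementsLE.exists_tendsto [CompleteSpace X] {l : Filter α} [l.NeBot] {c : ℝ}
    (hf : IncrementsLE f g s) (hs : s ∈ l) (hg : Tendsto g l (𝓝 c)) :
    ∃ y, Tendsto f l (𝓝 y) := by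
  refine CompleteSpace.complete (f := map f l) (cauchy_map_iff.2 ⟨‹_›, ?_⟩)
  have hg' := tendsto_uniformity_iff_dist_tendsto_zero.1 (cauchy_map_iff.1 hg.cauchy_map).2
  refine tendsto_uniformity_iff_dist_tendsto_zero.2
    (squeeze_zero' (.of_forall fun _ => dist_nonneg) ?_ hg')
  filter_upwards [prod_mem_prod hs hs] with p hp
  rw [dist_eq_norm]
  exact hf.norm_sub_le_dist hp.1 hp.2

theorem IncrementsLE.mem_regulated [CompleteSpace X] {a b : ℝ} {f : ℝ → X} {g : ℝ → ℝ}
    (hf : IncrementsLE f g (Icc a b)) : f ∈ regulated a b X := by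
  have hg := hf.monotoneOn
  refine ⟨fun t ht => ?_, fun t ht => ?_⟩
  · have hsub : Ioo a t ⊆ Icc a b := fun r hr => ⟨hr.1.le, hr.2.le.trans ht.2⟩
    exact hf.exists_tendsto (mem_of_superset (Ioo_mem_nhdsLT ht.1) hsub)
      ((hg.mono hsub).tendsto_nhdsWithin_Ioo_left (nonempty_Ioo.2 ht.1)
        ⟨g t, forall_mem_image.2 fun r hr => hg (hsub hr) ⟨ht.1.le, ht.2⟩ hr.2.le⟩)
  · have hsub : Ioo t b ⊆ Icc a b := fun r hr => ⟨ht.1.trans hr.1.le, hr.2.le⟩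
    exact hf.exists_tendsto (mem_of_superset (Ioo_mem_nhdsGT ht.2) hsub)
      ((hg.mono hsub).tendsto_nhdsWithin_Ioo_right (nonempty_Ioo.2 ht.2)
        ⟨g t, forall_mem_image.2 fun r hr => hg ⟨ht.1, ht.2.le⟩ (hsub hr) hr.1.le⟩)

end IncrementsLimits

/-! ### Tagged partitions -/

namespace TaggedPart

variable {a b c : ℝ}

/-- The partition of `[a, b]` into the single interval `[a, b]`, tagged by `τ`. -/
def single {τ : ℝ} (hτ : τ ∈ Icc a b) : TaggedPart a b where
  ν := 1
  pt j := if j = 0 then a else b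
  tag _ := τ
  pt_zero := rfl
  pt_last := rfl
  pt_le j hj := by simpa [Nat.lt_one_iff.1 hj] using hτ.1.trans hτ.2
  tag_mem j hj := by simpa [Nat.lt_one_iff.1 hj] using hτ

theorem isFine_single {τ : ℝ} (hτ : τ ∈ Icc a b) {δ : ℝ → ℝ}
    (h : Icc a b ⊆ Ioo (τ - δ τ) (τ + δ τ)) : (single hτ).IsFine δ := by
  intro j hj
  obtain rfl : j = 0 := Nat.lt_one_iff.1 hj
  exact h

theorem pt_le_pt (P : TaggedPart a b) {j k : ℕ} (hjk : j ≤ k) (hk : k ≤ P.ν) :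
    P.pt j ≤ P.pt k := by
  induction k, hjk using Nat.le_induction with
  | base => exact le_rfl
  | succ k _ ih => exact (ih (Nat.le_of_succ_le hk)).trans (P.pt_le k hk)

theorem pt_mem_Icc (P : TaggedPart a b) {j : ℕ} (hj : j ≤ P.ν) : P.pt j ∈ Icc a b := by
  simpa only [P.pt_zero, P.pt_last, mem_Icc] using
    And.intro (P.pt_le_pt j.zero_le hj) (P.pt_le_pt hj le_rfl)

theorem tag_mem_Icc (P : TaggedPart a b) {j : ℕ} (hj : j < P.ν) : P.tag j ∈ Icc a b :=
  Icc_subset_Icc (P.pt_mem_Icc hj.le).1 (P.pt_mem_Icc hj).2 (P.tag_mem j hj)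

theorem IsFine.mono {P : TaggedPart a b} {δ δ' : ℝ → ℝ} (hP : P.IsFine δ)
    (h : ∀ s, δ s ≤ δ' s) : P.IsFine δ' :=
  fun j hj => (hP j hj).trans (Ioo_subset_Ioo (sub_le_sub_left (h _) _) (by gcongr; exact h _))

section append

variable (P : TaggedPart a c) (Q : TaggedPart c b)

/-- The division points of `P` followed by those of `Q`, the common point `c` listed once. -/
def appendPt (j : ℕ) : ℝ :=
  if j ≤ P.ν then P.pt j else Q.pt (j - P.ν)

/-- The tags of `P` followed by those of `Q`. -/
def appendTag (j : ℕ) : ℝ :=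
  if j < P.ν then P.tag j else Q.tag (j - P.ν)

theorem appendPt_of_le {j : ℕ} (hj : j ≤ P.ν) : P.appendPt Q j = P.pt j :=
  if_pos hj

theorem appendPt_add (j : ℕ) : P.appendPt Q (P.ν + j) = Q.pt j := by
  cases j with
  | zero => rw [add_zero, appendPt_of_le P Q le_rfl, P.pt_last, Q.pt_zero]
  | succ j => rw [appendPt, if_neg (by lia), Nat.add_sub_cancel_left]

theorem appendTag_of_lt {j : ℕ} (hj : j < P.ν) : P.appendTag Q j = P.tag j :=
  if_pos hj

theorem appendTag_add (j : ℕ) : P.appendTag Q (P.ν + j) = Q.tag j := by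
  rw [appendTag, if_neg (by lia), Nat.add_sub_cancel_left]

variable {P Q}

theorem forall_append {p : ℝ → ℝ → ℝ → Prop} (hP : ∀ j < P.ν, p (P.tag j) (P.pt j) (P.pt (j + 1)))
    (hQ : ∀ j < Q.ν, p (Q.tag j) (Q.pt j) (Q.pt (j + 1))) :
    ∀ j < P.ν + Q.ν, p (P.appendTag Q j) (P.appendPt Q j) (P.appendPt Q (j + 1)) := by
  intro j hj
  rcases lt_or_ge j P.ν with hjP | hjP
  · rw [appendTag_of_lt P Q hjP, appendPt_of_le P Q hjP.le, appendPt_of_le P Q hjP]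
    exact hP j hjP
  · obtain ⟨k, rfl⟩ := Nat.exists_eq_add_of_le hjP
    rw [appendTag_add, appendPt_add, add_assoc, appendPt_add]
    exact hQ k (by lia)

variable (P Q)

/-- The partition of `[a, b]` obtained by joining a partition of `[a, c]` and one of `[c, b]`. -/
def append : TaggedPart a b where
  ν := P.ν + Q.ν
  pt := P.appendPt Q
  tag := P.appendTag Q
  pt_zero := by rw [appendPt_of_le P Q P.ν.zero_le, P.pt_zero]
  pt_last := by rw [appendPt_add, Q.pt_last]
  pt_le := forall_append (p := fun _ r t => r ≤ t) P.pt_le Q.pt_le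
  tag_mem := forall_append (p := fun τ r t => τ ∈ Icc r t) P.tag_mem Q.tag_mem

theorem kSum_append {X : Type*} [AddCommGroup X] (U : ℝ → ℝ → X) :
    (P.append Q).kSum U = P.kSum U + Q.kSum U := by
  refine (Finset.sum_range_add _ _ _).trans (congrArg₂ _ (Finset.sum_congr rfl fun j hj => ?_)
    (Finset.sum_congr rfl fun j _ => ?_))
  · have hj := Finset.mem_range.1 hj
    simp only [append, appendTag_of_lt P Q hj, appendPt_of_le P Q hj.le, appendPt_of_le P Q hj]
  · simp only [append, appendTag_add, add_assoc, appendPt_add]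

variable {P Q}

theorem IsFine.append {δ : ℝ → ℝ} (hP : P.IsFine δ) (hQ : Q.IsFine δ) : (P.append Q).IsFine δ :=
  forall_append (p := fun τ r t => Icc r t ⊆ Ioo (τ - δ τ) (τ + δ τ)) hP hQ

end append

/-- Cousin's lemma. -/
theorem exists_isFine (hab : a ≤ b) {δ : ℝ → ℝ} (hδ : ∀ s ∈ Icc a b, 0 < δ s) :
    ∃ P : TaggedPart a b, P.IsFine δ := by
  set S : Set ℝ := {s ∈ Icc a b | ∃ P : TaggedPart a s, P.IsFine δ}
  have haS : a ∈ S := by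
    have ha : a ∈ Icc a a := left_mem_Icc.2 le_rfl
    have hδa := hδ a (left_mem_Icc.2 hab)
    refine ⟨left_mem_Icc.2 hab, single ha, isFine_single ha ?_⟩
    rw [Icc_self, singleton_subset_iff]
    exact ⟨by linarith, by linarith⟩
  have hSb : ∀ s ∈ S, s ≤ b := fun s hs => hs.1.2
  set c := sSup S
  have hc : c ∈ Icc a b := ⟨le_csSup ⟨b, hSb⟩ haS, csSup_le ⟨a, haS⟩ hSb⟩
  have hδc := hδ c hc
  obtain ⟨s, hs, hcs⟩ := exists_lt_of_lt_csSup ⟨a, haS⟩ (sub_lt_self c hδc)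
  have hsc : s ≤ c := le_csSup ⟨b, hSb⟩ hs
  have extend : ∀ t ∈ Icc c b, t < c + δ c → t ∈ S := fun t ht htc => by
    obtain ⟨P, hP⟩ := hs.2
    have hcst : c ∈ Icc s t := ⟨hsc, ht.1⟩
    exact ⟨⟨hc.1.trans ht.1, ht.2⟩, P.append (single hcst),
      hP.append (isFine_single hcst (Icc_subset_Ioo hcs htc))⟩
  have hcb : c = b := by
    by_contra hne
    obtain ⟨t, hct, ht⟩ := exists_between (lt_min (hc.2.lt_of_ne hne) (lt_add_of_pos_right c hδc))
    have htS := extend t ⟨hct.le, (ht.trans_le (min_le_left _ _)).le⟩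
      (ht.trans_le (min_le_right _ _))
    exact hct.not_ge (le_csSup ⟨b, hSb⟩ htS)
  exact (extend b (right_mem_Icc.2 hc.2) (by linarith)).2

variable {X : Type*}

theorem kSum_add [AddCommGroup X] (P : TaggedPart a b) (U V : ℝ → ℝ → X) :
    P.kSum (fun τ t => U τ t + V τ t) = P.kSum U + P.kSum V := by
  simp only [kSum, ← Finset.sum_add_distrib, add_sub_add_comm]

theorem kSum_const_smul {𝕜 : Type*} [Ring 𝕜] [AddCommGroup X] [Module 𝕜 X] (P : TaggedPart a b)
    (c : 𝕜) (U : ℝ → ℝ → X) : P.kSum (fun τ t => c • U τ t) = c • P.kSum U := by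
  simp only [kSum, Finset.smul_sum, smul_sub]

theorem kSum_sub [AddCommGroup X] (P : TaggedPart a b) (U V : ℝ → ℝ → X) :
    P.kSum (fun τ t => U τ t - V τ t) = P.kSum U - P.kSum V := by
  simp only [kSum, ← Finset.sum_sub_distrib, sub_sub_sub_comm]

theorem norm_kSum_le [SeminormedAddCommGroup X] (P : TaggedPart a b) {U : ℝ → ℝ → X} {g : ℝ → ℝ}
    (hU : ∀ τ ∈ Icc a b, IncrementsLE (U τ) g (Icc a b)) : ‖P.kSum U‖ ≤ g b - g a :=
  calc ‖P.kSum U‖ ≤ ∑ j ∈ Finset.range P.ν, (g (P.pt (j + 1)) - g (P.pt j)) :=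
        norm_sum_le_of_le _ fun j hj => by
          have hj := Finset.mem_range.1 hj
          exact hU _ (P.tag_mem_Icc hj) (P.pt_mem_Icc hj.le) (P.pt_mem_Icc hj) (P.pt_le j hj)
    _ = g b - g a := by rw [Finset.sum_range_sub fun j => g (P.pt j), P.pt_last, P.pt_zero]

/-- The filter on tagged partitions of `[a, b]` generated by the sets of `δ`-fine partitions, for
`δ` positive on `[a, b]`: the Kurzweil integral is a limit along it. -/
def fineFilter (a b : ℝ) : Filter (TaggedPart a b) :=
  ⨅ (δ : ℝ → ℝ) (_ : ∀ s ∈ Icc a b, 0 < δ s), 𝓟 {P | P.IsFine δ}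

theorem hasBasis_fineFilter (a b : ℝ) :
    (fineFilter a b).HasBasis (fun δ : ℝ → ℝ => ∀ s ∈ Icc a b, 0 < δ s) fun δ =>
      {P | P.IsFine δ} :=
  hasBasis_biInf_principal'
    (fun δ hδ δ' hδ' => ⟨fun s => min (δ s) (δ' s), fun s hs => lt_min (hδ s hs) (hδ' s hs),
      fun P (hP : P.IsFine _) => hP.mono fun _ => min_le_left _ _,
      fun P (hP : P.IsFine _) => hP.mono fun _ => min_le_right _ _⟩)
    ⟨fun _ => 1, fun _ _ => one_pos⟩

theorem fineFilter_neBot (hab : a ≤ b) : (fineFilter a b).NeBot :=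
  (hasBasis_fineFilter a b).neBot_iff.2 fun hδ => exists_isFine hab hδ

theorem tendsto_append (hac : a ≤ c) (hcb : c ≤ b) :
    Tendsto (fun p : TaggedPart a c × TaggedPart c b => p.1.append p.2)
      (fineFilter a c ×ˢ fineFilter c b) (fineFilter a b) :=
  ((hasBasis_fineFilter a c).prod (hasBasis_fineFilter c b)).tendsto_iff
    (hasBasis_fineFilter a b) |>.2 fun δ hδ =>
      ⟨(δ, δ), ⟨fun s hs => hδ s (Icc_subset_Icc_right hcb hs),
        fun s hs => hδ s (Icc_subset_Icc_left hac hs)⟩, fun _ hp => hp.1.append hp.2⟩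

end TaggedPart

/-! ### The Kurzweil integral as a limit -/

section Integral

variable {X : Type*} [NormedAddCommGroup X] {U V : ℝ → ℝ → X} {a b c : ℝ} {I J : X}

theorem hasKurzweilIntegral_iff_tendsto :
    HasKurzweilIntegral U a b I ↔
      Tendsto (fun P => P.kSum U) (TaggedPart.fineFilter a b) (𝓝 I) := by
  simp only [(TaggedPart.hasBasis_fineFilter a b).tendsto_iff Metric.nhds_basis_ball,
    HasKurzweilIntegral, mem_ball_iff_norm, mem_ofPred_eq]

namespace HasKurzweilIntegral

theorem unique (hab : a ≤ b) (hI : HasKurzweilIntegral U a b I)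
    (hJ : HasKurzweilIntegral U a b J) : I = J :=
  have := TaggedPart.fineFilter_neBot hab
  tendsto_nhds_unique (hasKurzweilIntegral_iff_tendsto.1 hI) (hasKurzweilIntegral_iff_tendsto.1 hJ)

theorem add (hU : HasKurzweilIntegral U a b I) (hV : HasKurzweilIntegral V a b J) :
    HasKurzweilIntegral (fun τ t => U τ t + V τ t) a b (I + J) := by
  rw [hasKurzweilIntegral_iff_tendsto] at *
  simpa only [TaggedPart.kSum_add] using hU.add hV

theorem sub (hU : HasKurzweilIntegral U a b I) (hV : HasKurzweilIntegral V a b J) :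
    HasKurzweilIntegral (fun τ t => U τ t - V τ t) a b (I - J) := by
  rw [hasKurzweilIntegral_iff_tendsto] at *
  simpa only [TaggedPart.kSum_sub] using hU.sub hV

theorem const_smul {𝕜 : Type*} [Ring 𝕜] [Module 𝕜 X] [ContinuousConstSMul 𝕜 X] (k : 𝕜)
    (hU : HasKurzweilIntegral U a b I) :
    HasKurzweilIntegral (fun τ t => k • U τ t) a b (k • I) := by
  rw [hasKurzweilIntegral_iff_tendsto] at *
  simpa only [TaggedPart.kSum_const_smul] using Tendsto.const_smul hU k

theorem kurzweilIntegral_eq (hab : a ≤ b) (hI : HasKurzweilIntegral U a b I) :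
    kurzweilIntegral U a b = I := by
  have h : KurzweilIntegrable U a b := ⟨I, hI⟩
  rw [kurzweilIntegral, dif_pos h]
  exact (Classical.choose_spec h).unique hab hI

theorem sub_left (hac : a ≤ c) (hcb : c ≤ b) (hI : HasKurzweilIntegral U a b I)
    (hJ : HasKurzweilIntegral U a c J) : HasKurzweilIntegral U c b (I - J) := by
  rw [hasKurzweilIntegral_iff_tendsto] at *
  have := TaggedPart.fineFilter_neBot hac
  have hQ := (hI.comp (TaggedPart.tendsto_append hac hcb)).sub
    (hJ.comp (tendsto_fst (g := TaggedPart.fineFilter c b)))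
  rw [← map_snd_prod (TaggedPart.fineFilter a c) (TaggedPart.fineFilter c b), tendsto_map'_iff]
  simpa only [Function.comp_def, TaggedPart.kSum_append, add_sub_cancel_left] using hQ

theorem norm_le {g : ℝ → ℝ} (hab : a ≤ b) (hU : ∀ τ ∈ Icc a b, IncrementsLE (U τ) g (Icc a b))
    (hI : HasKurzweilIntegral U a b I) : ‖I‖ ≤ g b - g a :=
  have := TaggedPart.fineFilter_neBot hab
  le_of_tendsto (hasKurzweilIntegral_iff_tendsto.1 hI).norm
    (.of_forall fun P => P.norm_kSum_le hU)

end HasKurzweilIntegral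

theorem KurzweilIntegrable.hasKurzweilIntegral (hU : KurzweilIntegrable U a b) :
    HasKurzweilIntegral U a b (kurzweilIntegral U a b) := by
  rw [kurzweilIntegral, dif_pos hU]
  exact Classical.choose_spec hU

theorem IncrementsLE.of_hasKurzweilIntegral {g : ℝ → ℝ} {f : ℝ → X}
    (hU : ∀ τ ∈ Icc a b, IncrementsLE (U τ) g (Icc a b))
    (hf : ∀ s ∈ Icc a b, HasKurzweilIntegral U a s (f s)) : IncrementsLE f g (Icc a b) := by
  intro r hr t ht hrt
  have hsub : Icc r t ⊆ Icc a b := Icc_subset_Icc hr.1 ht.2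
  exact ((hf t ht).sub_left hr.1 hrt (hf r hr)).norm_le hrt
    fun τ hτ => (hU τ (hsub hτ)).mono hsub

theorem hasKurzweilIntegral_of_tendsto {ι : Type*} {u : Filter ι} [u.NeBot]
    {V : ι → ℝ → ℝ → X} {I : ι → X} {g : ℝ → ℝ}
    (hV : ∀ᶠ i in u, HasKurzweilIntegral (V i) a b (I i)) (hI : Tendsto I u (𝓝 J))
    (hVU : ∀ ε > 0, ∀ᶠ i in u, ∀ τ ∈ Icc a b,
      IncrementsLE (fun t => V i τ t - U τ t) (fun t => ε * g t) (Icc a b)) :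
    HasKurzweilIntegral U a b J := by
  simp only [hasKurzweilIntegral_iff_tendsto] at *
  refine TendstoUniformly.tendsto_of_eventually_tendsto (F := fun i P => P.kSum (V i))
    (Metric.tendstoUniformly_iff.2 fun ε hε => ?_) hV hI
  have hη : 0 < ε / (|g b - g a| + 1) := by positivity
  filter_upwards [hVU _ hη] with i hi P
  rw [dist_eq_norm', ← TaggedPart.kSum_sub]
  calc ‖P.kSum fun τ t => V i τ t - U τ t‖
      ≤ ε / (|g b - g a| + 1) * (g b - g a) := by simpa only [mul_sub] using P.norm_kSum_le hi
    _ ≤ ε / (|g b - g a| + 1) * |g b - g a| := by gcongr; exact le_abs_self _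
    _ < ε := by
      rw [div_mul_eq_mul_div, div_lt_iff₀ (by positivity)]
      gcongr
      exact lt_add_one _

end Integral

/-! ### Linear relations that are compact perturbations of the identity -/

theorem exists_lt_dist_lt_of_totallyBounded {α : Type*} [PseudoMetricSpace α] {s : Set α}
    (hs : TotallyBounded s) {f : ℕ → α} (hf : ∀ k, f k ∈ s) {ε : ℝ} (hε : 0 < ε) :
    ∃ j k, j < k ∧ dist (f k) (f j) < ε := by
  obtain ⟨t, ht, hst⟩ := Metric.totallyBounded_iff.1 hs (ε / 2) (half_pos hε)
  choose c hct hfc using fun k => mem_iUnion₂.1 (hst (hf k))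
  have := ht.to_subtype
  obtain ⟨j, k, hne, hc⟩ := Finite.exists_ne_map_eq_of_infinite fun k => (⟨c k, hct k⟩ : t)
  have hcjk : c j = c k := congrArg Subtype.val hc
  have hjk : dist (f k) (f j) < ε := by
    have := dist_triangle_right (f k) (f j) (c k)
    have hj := hfc j
    rw [hcjk, Metric.mem_ball] at hj
    linarith [Metric.mem_ball.1 (hfc k)]
  rcases hne.lt_or_gt with h | h
  · exact ⟨j, k, h, hjk⟩
  · exact ⟨k, j, h, dist_comm (f k) (f j) ▸ hjk⟩

section RieszSchauder

variable {𝕜 E : Type*} [NontriviallyNormedField 𝕜] [NormedAddCommGroup E] [NormedSpace 𝕜 E]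

theorem exists_seq_norm_le_one_le_norm_sub_of_strictMono {V : ℕ → Submodule 𝕜 E}
    (hV : StrictMono V) (hclosed : ∀ k, IsClosed (V k : Set E)) :
    ∃ (R : ℝ) (v : ℕ → E), (∀ k, v k ∈ V (k + 1)) ∧ (∀ k, ‖v k‖ ≤ R) ∧
      ∀ k, ∀ y ∈ V k, 1 ≤ ‖v k - y‖ := by
  obtain ⟨c, hc⟩ := NormedField.exists_one_lt_norm 𝕜
  have riesz : ∀ k, ∃ v ∈ V (k + 1), ‖v‖ ≤ ‖c‖ + 1 ∧ ∀ y ∈ V k, 1 ≤ ‖v - y‖ := by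
    intro k
    obtain ⟨x, hx, hxk⟩ := SetLike.exists_of_lt (hV k.lt_succ_self)
    obtain ⟨v, hvR, hv⟩ := riesz_lemma_of_norm_lt hc (lt_add_one ‖c‖)
      (F := (V k).comap (V (k + 1)).subtype) ((hclosed k).preimage continuous_subtype_val)
      ⟨⟨x, hx⟩, hxk⟩
    exact ⟨v, v.2, hvR, fun y hy => hv ⟨y, hV.monotone k.le_succ hy⟩ hy⟩
  choose v hvV hvR hv using riesz
  exact ⟨‖c‖ + 1, v, hvV, hvR, hv⟩

variable {S : Submodule 𝕜 (E × E)}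

theorem eq_zero_of_zero_mem_linearRelation
    (hS : Bornology.IsBounded ((fun p : E × E => p.1 - p.2) '' {p | p ∈ S ∧ ‖p.1‖ ≤ 0}))
    {q : E} (hq : (0, q) ∈ S) : q = 0 := by
  obtain ⟨C, hC⟩ := hS.exists_norm_le
  by_contra hne
  obtain ⟨c, hc⟩ := NormedField.exists_lt_norm 𝕜 (C / ‖q‖)
  have hcS : ((0 : E), c • q) ∈ S := by simpa using S.smul_mem c hq
  have hle : ‖c • q‖ ≤ C := by simpa using hC _ ⟨_, ⟨hcS, norm_zero.le⟩, rfl⟩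
  rw [norm_smul] at hle
  exact hc.not_ge ((le_div_iff₀ (norm_pos_iff.2 hne)).2 hle)

theorem exists_mem_span_of_mem_span_succ {u : ℕ → E} (hu₀ : (u 0, 0) ∈ S)
    (hu : ∀ k, (u (k + 1), u k) ∈ S) (k : ℕ) {v : E}
    (hv : v ∈ Submodule.span 𝕜 (u '' Iio (k + 1))) :
    ∃ q ∈ Submodule.span 𝕜 (u '' Iio k), (v, q) ∈ S := by
  set V := Submodule.span 𝕜 (u '' Iio k)
  have hle : Submodule.span 𝕜 (u '' Iio (k + 1)) ≤
      (S ⊓ V.comap (LinearMap.snd 𝕜 E E)).map (LinearMap.fst 𝕜 E E) := by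
    refine Submodule.span_le.2 (image_subset_iff.2 fun j hj => ?_)
    cases j with
    | zero => exact ⟨_, ⟨hu₀, V.zero_mem⟩, rfl⟩
    | succ j => exact ⟨_, ⟨hu j, Submodule.subset_span ⟨j, Nat.lt_of_succ_lt_succ hj, rfl⟩⟩, rfl⟩
  obtain ⟨p, ⟨hpS, hpV⟩, rfl⟩ := hle hv
  exact ⟨p.2, hpV, hpS⟩

theorem strictMono_span_of_forall_mem (hS : ∀ q, ((0 : E), q) ∈ S → q = 0) {u : ℕ → E}
    (hne : u 0 ≠ 0) (hu₀ : (u 0, 0) ∈ S) (hu : ∀ k, (u (k + 1), u k) ∈ S) :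
    StrictMono fun k => Submodule.span 𝕜 (u '' Iio k) := by
  have hnot : ∀ k, u k ∉ Submodule.span 𝕜 (u '' Iio k) := by
    intro k
    induction k with
    | zero => simpa using hne
    | succ k ih =>
      intro hk
      obtain ⟨q, hq, hqS⟩ := exists_mem_span_of_mem_span_succ hu₀ hu k hk
      have hdiff : ((0 : E), q - u k) ∈ S := by simpa using S.sub_mem hqS (hu k)
      exact ih (sub_eq_zero.1 (hS _ hdiff) ▸ hq)
  refine strictMono_nat_of_lt_succ fun k => SetLike.lt_iff_le_and_exists.2 ⟨?_, u k, ?_, hnot k⟩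
  · exact Submodule.span_mono (image_mono (Iio_subset_Iio k.le_succ))
  · exact Submodule.subset_span ⟨k, k.lt_succ_self, rfl⟩

-- If `(vⱼ, qⱼ)` and `(vₖ, qₖ)` are in `S`, `j < k`, then `qⱼ`, `vⱼ` and `qₖ` are in the span `Vₖ`,
-- every point of which is at distance `≥ 1` from `vₖ`, so the values `vₖ - qₖ` are separated.
theorem eq_zero_of_mem_of_surjective [CompleteSpace 𝕜]
    (hS : ∀ R : ℝ, TotallyBounded ((fun p : E × E => p.1 - p.2) '' {p | p ∈ S ∧ ‖p.1‖ ≤ R}))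
    (hsurj : ∀ p ∈ S, ∃ w, (w, p.1) ∈ S) {z : E} (hz : (z, 0) ∈ S) : z = 0 := by
  by_contra hne
  choose! next hnext using hsurj
  set u : ℕ → E × E := fun k => (fun p => (next p, p.1))^[k] (z, 0)
  have huS : ∀ k, u k ∈ S := fun k => by
    induction k with
    | zero => exact hz
    | succ k ih =>
      simp only [u, Function.iterate_succ_apply']
      exact hnext _ ih
  have hu : ∀ k, ((u (k + 1)).1, (u k).1) ∈ S := fun k => by
    simpa only [u, Function.iterate_succ_apply'] using hnext _ (huS k)
  set V : ℕ → Submodule 𝕜 E := fun k => Submodule.span 𝕜 ((fun k => (u k).1) '' Iio k)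
  have hV : StrictMono V := strictMono_span_of_forall_mem
    (fun q => eq_zero_of_zero_mem_linearRelation (hS 0).isBounded) hne hz hu
  have hclosed : ∀ k, IsClosed (V k : Set E) := fun k =>
    have := FiniteDimensional.span_of_finite 𝕜 ((finite_Iio k).image fun k => (u k).1)
    (V k).closed_of_finiteDimensional
  obtain ⟨R, v, hvV, hvR, hv⟩ := exists_seq_norm_le_one_le_norm_sub_of_strictMono hV hclosed
  choose q hqV hqS using fun k => exists_mem_span_of_mem_span_succ (u := fun k => (u k).1)
    hz hu k (hvV k)
  obtain ⟨j, k, hjk, hlt⟩ := exists_lt_dist_lt_of_totallyBounded (hS R)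
    (f := fun k => v k - q k) (fun k => ⟨(v k, q k), ⟨hqS k, hvR k⟩, rfl⟩) one_pos
  refine hlt.not_ge ?_
  rw [dist_eq_norm, sub_sub]
  exact hv k _ (add_mem (hqV k) (sub_mem (hV.monotone hjk (hvV j)) (hV.monotone hjk.le (hqV j))))

end RieszSchauder

/-! ### Regulated functions and Helly's theorem -/

section Regulated

variable {E : Type*} [NormedAddCommGroup E] {a b T : ℝ} {x : ℝ → E}

/-- The regulated functions as a subspace of the space of all functions. -/
def regulatedSubmodule (a b : ℝ) (E : Type*) [NormedAddCommGroup E] [NormedSpace ℝ E] :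
    Submodule ℝ (ℝ → E) where
  carrier := regulated a b E
  zero_mem' := ⟨fun _ _ => ⟨0, tendsto_const_nhds⟩, fun _ _ => ⟨0, tendsto_const_nhds⟩⟩
  add_mem' := fun hx hy =>
    ⟨fun t ht => (hx.1 t ht).elim fun _ hl => (hy.1 t ht).elim fun _ hm => ⟨_, hl.add hm⟩,
      fun t ht => (hx.2 t ht).elim fun _ hl => (hy.2 t ht).elim fun _ hm => ⟨_, hl.add hm⟩⟩
  smul_mem' := fun c _ hx =>
    ⟨fun t ht => (hx.1 t ht).elim fun _ hl => ⟨_, hl.const_smul c⟩,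
      fun t ht => (hx.2 t ht).elim fun _ hl => ⟨_, hl.const_smul c⟩⟩

theorem exists_isBounded_image_of_mem_regulated (hx : x ∈ regulated a b E) {t : ℝ}
    (ht : t ∈ Icc a b) : ∃ s ∈ 𝓝[Icc a b] t, Bornology.IsBounded (x '' s) := by
  have hleft : ∃ s ∈ 𝓝[Ico a t] t, Bornology.IsBounded (x '' s) := by
    rcases ht.1.eq_or_lt with rfl | hat
    · exact ⟨∅, by simp, by simp⟩
    · obtain ⟨l, hl⟩ := hx.1 t ⟨hat, ht.2⟩
      exact Metric.exists_isBounded_image_of_tendsto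
        (hl.mono_left (nhdsWithin_mono _ fun r hr => hr.2))
  have hright : ∃ s ∈ 𝓝[Ioc t b] t, Bornology.IsBounded (x '' s) := by
    rcases ht.2.eq_or_lt with rfl | htb
    · exact ⟨∅, by simp, by simp⟩
    · obtain ⟨l, hl⟩ := hx.2 t ⟨ht.1, htb⟩
      exact Metric.exists_isBounded_image_of_tendsto
        (hl.mono_left (nhdsWithin_mono _ fun r hr => hr.1))
  obtain ⟨s, hs, hsb⟩ := hleft
  obtain ⟨s', hs', hsb'⟩ := hright
  refine ⟨s ∪ {t} ∪ s', ?_, ?_⟩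
  · have hIcc : Icc a b = Ico a t ∪ {t} ∪ Ioc t b := by
      rw [union_assoc, singleton_union, Ioc_insert_left ht.2, Ico_union_Icc_eq_Icc ht.1 ht.2]
    rw [hIcc, nhdsWithin_union, nhdsWithin_union, nhdsWithin_singleton]
    exact union_mem_sup (union_mem_sup hs (mem_pure.2 rfl)) hs'
  · rw [image_union, image_union, image_singleton]
    exact (hsb.union Bornology.isBounded_singleton).union hsb'

theorem exists_forall_norm_le_of_mem_regulated (hx : x ∈ regulated a b E) :
    ∃ C, ∀ t ∈ Icc a b, ‖x t‖ ≤ C := by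
  have hbdd : Bornology.IsBounded (x '' Icc a b) :=
    isCompact_Icc.induction_on (p := fun s => Bornology.IsBounded (x '' s))
      (by simp) (fun s t hst ht => ht.subset (image_mono hst))
      (fun s t hs ht => by simpa only [image_union] using hs.union ht)
      fun t ht => exists_isBounded_image_of_mem_regulated hx ht
  simpa only [forall_mem_image] using hbdd.exists_norm_le

theorem norm_le_supNorm (hx : x ∈ regulated 0 T E) {t : ℝ} (ht : t ∈ Icc 0 T) :
    ‖x t‖ ≤ supNorm T x := by
  obtain ⟨C, hC⟩ := exists_forall_norm_le_of_mem_regulated hx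
  exact le_ciSup (f := fun t : Icc (0 : ℝ) T => ‖x t‖)
    ⟨C, forall_mem_range.2 fun t => hC t t.2⟩ ⟨t, ht⟩

theorem supNorm_nonneg (T : ℝ) (x : ℝ → E) : 0 ≤ supNorm T x :=
  Real.iSup_nonneg fun _ => norm_nonneg _

theorem exists_lt_norm_of_lt_supNorm {c : ℝ} (hc : 0 ≤ c) (hx : c < supNorm T x) :
    ∃ t ∈ Icc 0 T, c < ‖x t‖ := by
  by_contra! h
  exact hx.not_ge (Real.iSup_le (fun t => h t t.2) hc)

end Regulated

theorem exists_finite_forall_exists_dist_lt {α : Type*} {g : α → ℝ} {s : Set α}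
    (hg : TotallyBounded (g '' s)) {ε : ℝ} (hε : 0 < ε) :
    ∃ F ⊆ s, F.Finite ∧ ∀ t ∈ s, ∃ r ∈ F, dist (g t) (g r) < ε := by
  obtain ⟨F, hFs, hF, hcover⟩ :=
    exists_subset_image_finite_and.1 (Metric.finite_approx_of_totallyBounded hg ε hε)
  refine ⟨F, hFs, hF, fun t ht => ?_⟩
  simpa only [biUnion_image, mem_iUnion₂, Metric.mem_ball, exists_prop]
    using hcover (mem_image_of_mem g ht)

section Helly

variable {α X : Type*} [LinearOrder α] [SeminormedAddCommGroup X] [ProperSpace X] {g : α → ℝ}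
  {s : Set α} {C : ℝ}

theorem exists_tendstoUniformlyOn_of_incrementsLE {ι : Type*} (u : Ultrafilter ι)
    {f : ι → α → X} (hg : TotallyBounded (g '' s))
    (hf : ∀ᶠ i in u, IncrementsLE (f i) g s) (hC : ∀ᶠ i in u, ∀ t ∈ s, ‖f i t‖ ≤ C) :
    ∃ z, IncrementsLE z g s ∧ TendstoUniformlyOn f z u s := by
  have hlim : ∀ t ∈ s, ∃ y, Tendsto (fun i => f i t) u (𝓝 y) := fun t ht => by
    obtain ⟨y, -, hy⟩ := (isCompact_closedBall (0 : X) C).ultrafilter_le_nhds' (u.map (f · t))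
      (hC.mono fun i hi => mem_closedBall_zero_iff.2 (hi t ht))
    exact ⟨y, hy⟩
  choose! z hz using hlim
  have hzg : IncrementsLE z g s := fun r hr t ht hrt =>
    le_of_tendsto ((hz t ht).sub (hz r hr)).norm (hf.mono fun i hi => hi hr ht hrt)
  refine ⟨z, hzg, Metric.tendstoUniformlyOn_iff.2 fun ε hε => ?_⟩
  obtain ⟨F, hFs, hF, hcover⟩ :=
    exists_finite_forall_exists_dist_lt hg (show 0 < ε / 3 by positivity)
  have hclose : ∀ᶠ i in u, ∀ r ∈ F, dist (z r) (f i r) < ε / 3 :=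
    (eventually_all_finite hF).2 fun r hr => by
      filter_upwards [Metric.tendsto_nhds.1 (hz r (hFs hr)) (ε / 3) (by positivity)] with i hi
      rwa [dist_comm]
  filter_upwards [hf, hclose] with i hi hir t ht
  obtain ⟨r, hr, htr⟩ := hcover t ht
  calc dist (z t) (f i t) ≤ dist (z t) (z r) + dist (z r) (f i r) + dist (f i r) (f i t) :=
        dist_triangle4 _ _ _ _
    _ ≤ dist (g t) (g r) + dist (z r) (f i r) + dist (g t) (g r) := by
        rw [dist_comm (f i r), dist_eq_norm (z t), dist_eq_norm (f i t)]
        gcongr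
        · exact hzg.norm_sub_le_dist ht (hFs hr)
        · exact hi.norm_sub_le_dist ht (hFs hr)
    _ < ε := by linarith [hir r hr]

end Helly

theorem totallyBounded_setOf_incrementsLE {α X : Type*} [LinearOrder α] [NormedAddCommGroup X]
    [ProperSpace X] {g : α → ℝ} (hg : TotallyBounded (range g)) (C : ℝ) :
    TotallyBounded {f : lp (fun _ : α => X) ⊤ | ‖f‖ ≤ C ∧ IncrementsLE f g univ} := by
  refine totallyBounded_iff_ultrafilter.2 fun u hu => ?_
  obtain ⟨hC, hinc⟩ := eventually_and.1 (le_principal_iff.1 hu)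
  obtain ⟨z, -, hz⟩ := exists_tendstoUniformlyOn_of_incrementsLE u (image_univ ▸ hg) hinc
    (hC.mono fun f hf t _ => (lp.norm_apply_le_norm ENNReal.top_ne_zero f t).trans hf)
  refine Metric.cauchy_iff.2 ⟨u.neBot, fun ε hε => ⟨_,
    Metric.tendstoUniformlyOn_iff.1 hz (ε / 3) (by positivity), fun f hf f' hf' => ?_⟩⟩
  rw [dist_eq_norm]
  refine (lp.norm_le_of_forall_le (C := 2 * (ε / 3)) (by positivity) fun t => ?_).trans_lt
    (by linarith)
  calc ‖f t - f' t‖ = dist (f t) (f' t) := (dist_eq_norm _ _).symm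
    _ ≤ dist (z t) (f t) + dist (z t) (f' t) := dist_triangle_left _ _ _
    _ ≤ 2 * (ε / 3) := by linarith [hf t trivial, hf' t trivial]

/-! ### Linear equations -/

section LinearEquation

variable {E : Type*} [NormedAddCommGroup E] [NormedSpace ℝ E] {L : ℝ → ℝ → E →L[ℝ] E} {a b : ℝ}

/-- The pairs `(z, q)` for which the regulated function `z` solves the equation
`z(s) - z(b) - ∫_a^s D[L(τ, t) z(τ)] = q(s)` on `[a, b]`; the existence of the integrals is part of
the condition. -/
def linearSolutions (L : ℝ → ℝ → E →L[ℝ] E) (a b : ℝ) : Submodule ℝ ((ℝ → E) × (ℝ → E)) where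
  carrier := {w | w.1 ∈ regulated a b E ∧ ∀ s ∈ Icc a b,
    HasKurzweilIntegral (fun τ t => L τ t (w.1 τ)) a s (w.1 s - w.1 b - w.2 s)}
  zero_mem' := by
    refine ⟨(regulatedSubmodule a b E).zero_mem, fun s _ => ?_⟩
    simpa [hasKurzweilIntegral_iff_tendsto, TaggedPart.kSum] using tendsto_const_nhds
  add_mem' := by
    rintro w w' ⟨hw, hwI⟩ ⟨hw', hwI'⟩
    refine ⟨(regulatedSubmodule a b E).add_mem hw hw', fun s hs => ?_⟩
    simpa only [Prod.fst_add, Prod.snd_add, Pi.add_apply, map_add, add_sub_add_comm]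
      using (hwI s hs).add (hwI' s hs)
  smul_mem' := by
    rintro c w ⟨hw, hwI⟩
    refine ⟨(regulatedSubmodule a b E).smul_mem c hw, fun s hs => ?_⟩
    simpa only [Prod.smul_fst, Prod.smul_snd, Pi.smul_apply, map_smul, smul_sub]
      using (hwI s hs).const_smul c

theorem mem_linearSolutions {z q : ℝ → E} :
    (z, q) ∈ linearSolutions L a b ↔ z ∈ regulated a b E ∧ ∀ s ∈ Icc a b,
      HasKurzweilIntegral (fun τ t => L τ t (z τ)) a s (z s - z b - q s) := Iff.rfl

theorem incrementsLE_sub_of_mem_linearSolutions {z q : ℝ → E} {g : ℝ → ℝ} {R : ℝ}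
    (hL : ∀ τ ∈ Icc a b, IncrementsLE (L τ) g (Icc a b)) (hz : (z, q) ∈ linearSolutions L a b)
    (hR : ∀ t ∈ Icc a b, ‖z t‖ ≤ R) :
    IncrementsLE (fun t => z t - q t) (fun t => R * g t) (Icc a b) := by
  have h := IncrementsLE.of_hasKurzweilIntegral
    (fun τ hτ => (hL τ hτ).clm_apply (hR τ hτ)) (mem_linearSolutions.1 hz).2
  simpa only [sub_right_comm _ _ (q _), sub_sub_cancel_left, sub_add_cancel, sub_neg_eq_add]
    using h.sub_const (-z b)

theorem norm_sub_le_of_mem_linearSolutions {z q : ℝ → E} {g : ℝ → ℝ} {R : ℝ}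
    (hL : ∀ τ ∈ Icc a b, IncrementsLE (L τ) g (Icc a b)) (hz : (z, q) ∈ linearSolutions L a b)
    (hR : ∀ t ∈ Icc a b, ‖z t‖ ≤ R) {t : ℝ} (ht : t ∈ Icc a b) :
    ‖z t - q t‖ ≤ R * (g b - g a) + R := by
  have hb : b ∈ Icc a b := ⟨ht.1.trans ht.2, le_rfl⟩
  have hsub : Icc a t ⊆ Icc a b := Icc_subset_Icc_right ht.2
  have hI := (hz.2 t ht).norm_le ht.1 fun τ hτ =>
    ((hL τ (hsub hτ)).clm_apply (hR τ (hsub hτ))).mono hsub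
  calc ‖z t - q t‖ = ‖(z t - z b - q t) + z b‖ := by congr 1; abel
    _ ≤ (R * g t - R * g a) + R := norm_add_le_of_le hI (hR b hb)
    _ ≤ R * (g b - g a) + R := by
      rw [← mul_sub]
      gcongr
      · exact (norm_nonneg _).trans (hR b hb)
      · exact (hL t ht).monotoneOn ht hb ht.2

/-- The linear relation on the bounded functions on `[a, b]` formed by the restrictions of the pairs
in `linearSolutions`. -/
def linearRelation (L : ℝ → ℝ → E →L[ℝ] E) (a b : ℝ) :
    Submodule ℝ (lp (fun _ : Icc a b => E) ⊤ × lp (fun _ : Icc a b => E) ⊤) where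
  carrier := {p | ∃ w ∈ linearSolutions L a b,
    (∀ t : Icc a b, w.1 t = p.1 t) ∧ ∀ t : Icc a b, w.2 t = p.2 t}
  zero_mem' := ⟨0, zero_mem _, fun _ => rfl, fun _ => rfl⟩
  add_mem' := by
    rintro p p' ⟨w, hw, hwz, hwq⟩ ⟨w', hw', hwz', hwq'⟩
    exact ⟨w + w', add_mem hw hw', fun t => congr_arg₂ (· + ·) (hwz t) (hwz' t),
      fun t => congr_arg₂ (· + ·) (hwq t) (hwq' t)⟩
  smul_mem' := by
    rintro c p ⟨w, hw, hwz, hwq⟩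
    exact ⟨c • w, Submodule.smul_mem _ c hw, fun t => congr_arg (c • ·) (hwz t),
      fun t => congr_arg (c • ·) (hwq t)⟩

theorem totallyBounded_linearRelation [ProperSpace E] {g : ℝ → ℝ}
    (hL : ∀ τ ∈ Icc a b, IncrementsLE (L τ) g (Icc a b)) (R : ℝ) :
    TotallyBounded ((fun p => p.1 - p.2) '' {p | p ∈ linearRelation L a b ∧ ‖p.1‖ ≤ R}) := by
  have hg : range (fun t : Icc a b => g t) ⊆ Icc (g a) (g b) := range_subset_iff.2 fun t =>
    (hL t t.2).monotoneOn.mapsTo_Icc t.2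
  have hRg : TotallyBounded (range fun t : Icc a b => R * g t) :=
    range_comp (R * ·) (fun t : Icc a b => g t) ▸
      ((totallyBounded_Icc _ _).subset hg).image (uniformContinuous_const_smul R)
  refine (totallyBounded_setOf_incrementsLE hRg |R * (g b - g a) + R|).subset ?_
  rintro _ ⟨⟨v, q⟩, ⟨⟨⟨z, y⟩, hzy, hz, hy⟩, hvR⟩, rfl⟩
  have hR : ∀ t ∈ Icc a b, ‖z t‖ ≤ R := fun t ht =>
    (congr_arg norm (hz ⟨t, ht⟩)).trans_le
      ((lp.norm_apply_le_norm ENNReal.top_ne_zero v _).trans hvR)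
  have hsub : ∀ t : Icc a b, z t - y t = (v - q) t := fun t => congr_arg₂ (· - ·) (hz t) (hy t)
  refine ⟨lp.norm_le_of_forall_le (abs_nonneg _) fun t => ?_, fun r _ t _ hrt => ?_⟩
  · exact hsub t ▸ (norm_sub_le_of_mem_linearSolutions hL hzy hR t.2).trans (le_abs_self _)
  · simpa only [hsub] using incrementsLE_sub_of_mem_linearSolutions hL hzy hR r.2 t.2 hrt

theorem exists_forall_notMem_linearSolutions [ProperSpace E] {g : ℝ → ℝ}
    (hL : ∀ τ ∈ Icc a b, IncrementsLE (L τ) g (Icc a b)) {z : ℝ → E}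
    (hz : (z, 0) ∈ linearSolutions L a b) {t : ℝ} (ht : t ∈ Icc a b) (hzt : z t ≠ 0) :
    ∃ q ∈ regulated a b E, ∀ w, (w, q) ∉ linearSolutions L a b := by
  by_contra! hsurj
  have hmem : ∀ x ∈ regulated a b E, Memℓp (fun t : Icc a b => x t) ⊤ := fun x hx => by
    obtain ⟨C, hC⟩ := exists_forall_norm_le_of_mem_regulated hx
    exact memℓp_infty ⟨C, forall_mem_range.2 fun t => hC t t.2⟩
  have hz0 := eq_zero_of_mem_of_surjective (S := linearRelation L a b)
    (totallyBounded_linearRelation hL) ?_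
    (z := ⟨_, hmem z hz.1⟩) ⟨(z, 0), hz, fun _ => rfl, fun _ => rfl⟩
  · exact hzt (congr_fun (congr_arg Subtype.val hz0) ⟨t, ht⟩)
  · rintro p ⟨w, hw, hwz, -⟩
    obtain ⟨v, hv⟩ := hsurj w.1 hw.1
    exact ⟨⟨_, hmem v hv.1⟩, (v, w.1), hv, fun _ => rfl, hwz⟩

end LinearEquation

theorem exists_mem_linearSolutions_tendstoUniformlyOn {E ι : Type*} [NormedAddCommGroup E]
    [NormedSpace ℝ E] [ProperSpace E] (u : Ultrafilter ι) {L : ℝ → ℝ → E →L[ℝ] E} {a b C : ℝ}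
    {g : ℝ → ℝ} {Z : ι → ℝ → E} {W : ι → ℝ → ℝ → E}
    (hL : ∀ τ ∈ Icc a b, IncrementsLE (L τ) g (Icc a b))
    (hZ : ∀ i, ∀ t ∈ Icc a b, ‖Z i t‖ ≤ C)
    (hW : ∀ i, ∀ s ∈ Icc a b, HasKurzweilIntegral (W i) a s (Z i s - Z i b))
    (hWL : ∀ ε > 0, ∀ᶠ i in u, ∀ τ ∈ Icc a b,
      IncrementsLE (fun t => W i τ t - L τ t (Z i τ)) (fun t => ε * g t) (Icc a b)) :
    ∃ z, (z, 0) ∈ linearSolutions L a b ∧ TendstoUniformlyOn Z z u (Icc a b) := by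
  have hinc : ∀ᶠ i in u, IncrementsLE (Z i) (fun t => 1 * g t + C * g t) (Icc a b) := by
    filter_upwards [hWL 1 one_pos] with i hi
    have hWi : ∀ τ ∈ Icc a b, IncrementsLE (W i τ) (fun t => 1 * g t + C * g t) (Icc a b) :=
      fun τ hτ => by
        simpa only [sub_add_cancel] using (hi τ hτ).add ((hL τ hτ).clm_apply (hZ i τ hτ))
    simpa only [sub_neg_eq_add, sub_add_cancel] using
      (IncrementsLE.of_hasKurzweilIntegral hWi (hW i)).sub_const (-Z i b)
  obtain ⟨i, hi⟩ := hinc.exists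
  obtain ⟨z, hzg, hz⟩ := exists_tendstoUniformlyOn_of_incrementsLE u
    ((totallyBounded_Icc _ _).subset hi.monotoneOn.image_Icc_subset) hinc (.of_forall hZ)
  refine ⟨z, ⟨hzg.mem_regulated, fun s hs => ?_⟩, hz⟩
  have hb : b ∈ Icc a b := ⟨hs.1.trans hs.2, le_rfl⟩
  have hsub : Icc a s ⊆ Icc a b := Icc_subset_Icc_right hs.2
  refine hasKurzweilIntegral_of_tendsto (g := g) (.of_forall fun i => hW i s hs)
    (by simpa using (hz.tendsto_at hs).sub (hz.tendsto_at hb)) fun ε hε => ?_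
  filter_upwards [hWL (ε / 2) (half_pos hε), Metric.tendstoUniformlyOn_iff.1 hz (ε / 2)
    (half_pos hε)] with i hi hiz τ hτ
  have hLz := (hL τ (hsub hτ)).clm_apply (v := Z i τ - z τ) (C := ε / 2)
    (by simpa only [dist_eq_norm'] using (hiz τ (hsub hτ)).le)
  simpa only [map_sub, sub_add_sub_cancel, ← add_mul, add_halves]
    using ((hi τ (hsub hτ)).add hLz).mono hsub

/-! ### Linearization at a bifurcation point -/

section Field

variable {E X : Type*} [NormedAddCommGroup E] [NormedAddCommGroup X] {Ω : Set E} {a b T : ℝ}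
  {h ω : ℝ → ℝ} {x y : E}

theorem IncrementsLE.of_mem_classF {H : E → ℝ → X} (hh : MonotoneOn h (Icc a b))
    (hH : H ∈ classF Ω a b h ω) (hx : x ∈ Ω) : IncrementsLE (H x) h (Icc a b) := by
  simpa only [one_mul] using incrementsLE_const_mul_of_le_abs (C := 1) hh fun r hr t ht => by
    simpa only [one_mul] using hH.1 x hx r hr t ht

theorem IncrementsLE.sub_of_mem_classF {H : E → ℝ → X} (hh : MonotoneOn h (Icc a b))
    (hH : H ∈ classF Ω a b h ω) (hx : x ∈ Ω) (hy : y ∈ Ω) :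
    IncrementsLE (fun t => H x t - H y t) (fun t => ω ‖x - y‖ * h t) (Icc a b) :=
  incrementsLE_const_mul_of_le_abs hh fun r hr t ht => by
    rw [show H x t - H y t - (H x r - H y r) = H x t - H x r - H y t + H y r by abel]
    exact hH.2 x hx y hy r hr t ht

theorem IsModulus.exists_forall_le (hω : IsModulus ω) {ε : ℝ} (hε : 0 < ε) :
    ∃ δ > 0, ∀ r, 0 ≤ r → r < δ → ω r ≤ ε := by
  have hlim : Tendsto ω (𝓝[≥] 0) (𝓝 0) := by
    simpa only [hω.2.2] using (hω.2.1 0 self_mem_Ici).tendsto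
  obtain ⟨δ, hδ, hle⟩ := mem_nhdsGE_iff_exists_Ico_subset.1 (hlim.eventually (ge_mem_nhds hε))
  exact ⟨δ, hδ, fun r hr hrδ => hle ⟨hr, hrδ⟩⟩

theorem exists_incrementsLE_of_mem_classF {Λ : Set ℝ} {F : ℝ → E → ℝ → X}
    (hh : MonotoneOn h (Icc 0 T)) (hω : IsModulus ω) (hF : ∀ lam ∈ Λ, F lam ∈ classF Ω 0 T h ω)
    (hparam : ParamCondition Λ Ω T F) :
    ∃ g : ℝ → ℝ, (∀ lam ∈ Λ, ∀ x ∈ Ω, IncrementsLE (F lam x) g (Icc 0 T)) ∧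
      ∀ ε > 0, ∃ δ > 0, ∀ lam ∈ Λ, ∀ μ ∈ Λ, ∀ x ∈ Ω, ∀ y ∈ Ω, |lam - μ| < δ → ‖x - y‖ < δ →
        IncrementsLE (fun t => F lam x t - F μ y t) (fun t => ε * g t) (Icc 0 T) := by
  obtain ⟨γ, hγ, hδ⟩ := hparam
  refine ⟨fun t => h t + γ t, fun lam hlam x hx r hr t ht hrt => ?_, fun ε hε => ?_⟩
  · have := IncrementsLE.of_mem_classF hh (hF lam hlam) hx hr ht hrt
    linarith [hγ hr ht hrt]
  obtain ⟨δ₁, hδ₁, hω⟩ := hω.exists_forall_le hε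
  obtain ⟨δ₂, hδ₂, hF'⟩ := hδ ε hε
  refine ⟨min δ₁ δ₂, lt_min hδ₁ hδ₂, fun lam hlam μ hμ x hx y hy hlt hxy => ?_⟩
  have hspace := (IncrementsLE.sub_of_mem_classF hh (hF lam hlam) hx hy).const_mul_mono hh
    (hω _ (norm_nonneg _) (hxy.trans_le (min_le_left _ _)))
  have hpar : IncrementsLE (fun t => F lam y t - F μ y t) (fun t => ε * γ t) (Icc 0 T) :=
    incrementsLE_const_mul_of_le_abs hγ fun r hr t ht => by
      rw [show F lam y t - F μ y t - (F lam y r - F μ y r)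
        = F lam y t - F μ y t - F lam y r + F μ y r by abel]
      exact hF' y hy t ht r hr lam hlam μ hμ (hlt.trans_le (min_le_right _ _))
  simpa only [sub_add_sub_cancel, ← mul_add] using hspace.add hpar

end Field

theorem incrementsLE_smul_sub_sub_apply_of_hasFDerivAt {E X : Type*} [NormedAddCommGroup E]
    [NormedSpace ℝ E] [NormedAddCommGroup X] [NormedSpace ℝ X] {s : Set ℝ} {f : E → ℝ → X}
    {f' : E → ℝ → E →L[ℝ] X} {L : ℝ → E →L[ℝ] X} {g : ℝ → ℝ} {x y : E} {r : ℝ} (hr : 0 < r)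
    (hf : ∀ w ∈ Metric.closedBall x r, ∀ t ∈ s, HasFDerivAt (fun w => f w t) (f' w t) w)
    (hf' : ∀ w ∈ Metric.closedBall x r, IncrementsLE (fun t => f' w t - L t) g s)
    (hy : ‖y - x‖ ≤ r) :
    IncrementsLE (fun t => r⁻¹ • (f y t - f x t) - L t (r⁻¹ • (y - x))) g s := by
  intro t₁ ht₁ t₂ ht₂ h₁₂
  have hmean : ‖(f y t₂ - f y t₁) - (f x t₂ - f x t₁) - (L t₂ - L t₁) (y - x)‖
      ≤ (g t₂ - g t₁) * ‖y - x‖ := by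
    refine (convex_closedBall x r).norm_image_sub_le_of_norm_hasFDerivWithin_le'
      (f := fun w => f w t₂ - f w t₁)
      (fun w hw => ((hf w hw t₂ ht₂).sub (hf w hw t₁ ht₁)).hasFDerivWithinAt)
      (fun w hw => ?_) (Metric.mem_closedBall_self hr.le) (mem_closedBall_iff_norm.2 hy)
    rw [sub_sub_sub_comm]
    exact hf' w hw ht₁ ht₂ h₁₂
  have hg : 0 ≤ g t₂ - g t₁ :=
    sub_nonneg.2 ((hf' x (Metric.mem_closedBall_self hr.le)).monotoneOn ht₁ ht₂ h₁₂)
  calc _ = ‖r⁻¹ • ((f y t₂ - f y t₁) - (f x t₂ - f x t₁) - (L t₂ - L t₁) (y - x))‖ := by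
        simp only [map_smul, ← smul_sub, sub_apply]
        congr 2
        abel
    _ ≤ r⁻¹ * ((g t₂ - g t₁) * r) := by
        rw [norm_smul, norm_inv, Real.norm_of_nonneg hr.le]
        gcongr
        exact hmean.trans (by gcongr)
    _ = g t₂ - g t₁ := by field_simp

section Matrix

variable {n : ℕ}

theorem matCLM_sub (A B : Matrix (Fin n) (Fin n) ℝ) : matCLM (A - B) = matCLM A - matCLM B := by
  simp only [matCLM, map_sub]

theorem norm_entry_le (A : Matrix (Fin n) (Fin n) ℝ) (i j : Fin n) : ‖A i j‖ ≤ ‖A‖ := by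
  rw [← coe_nnnorm, ← coe_nnnorm, NNReal.coe_le_coe, Matrix.linfty_opNNNorm_def]
  exact (Finset.single_le_sum (f := fun j => ‖A i j‖₊) (fun _ _ => zero_le)
    (Finset.mem_univ j)).trans (Finset.le_sup (f := fun i => ∑ j, ‖A i j‖₊) (Finset.mem_univ i))

theorem norm_matCLM_le (A : Matrix (Fin n) (Fin n) ℝ) : ‖matCLM A‖ ≤ n * ‖A‖ := by
  refine ContinuousLinearMap.opNorm_le_bound _ (by positivity) fun v => ?_
  have hrow : ∀ i, ‖(matCLM A v) i‖ ≤ ‖A‖ * ‖v‖ := fun i => by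
    rw [show (matCLM A v) i = ∑ j, A i j * v j from rfl, PiLp.norm_eq_of_L1, Finset.mul_sum]
    refine norm_sum_le_of_le _ fun j _ => ?_
    rw [norm_mul]
    exact mul_le_mul_of_nonneg_right (norm_entry_le A i j) (norm_nonneg _)
  calc ‖matCLM A v‖ = ∑ i, ‖(matCLM A v) i‖ := PiLp.norm_eq_of_L1 _
    _ ≤ ∑ _i : Fin n, ‖A‖ * ‖v‖ := Finset.sum_le_sum fun i _ => hrow i
    _ = n * ‖A‖ * ‖v‖ := by
      rw [Finset.sum_const, Finset.card_univ, Fintype.card_fin, nsmul_eq_mul, mul_assoc]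

theorem IncrementsLE.matCLM {α : Type*} [Preorder α] {A : α → Matrix (Fin n) (Fin n) ℝ}
    {g : α → ℝ} {s : Set α} (hA : IncrementsLE A g s) :
    IncrementsLE (fun t => matCLM (A t)) (fun t => n * g t) s := fun r hr t ht hrt => by
  rw [← matCLM_sub, ← mul_sub]
  exact (norm_matCLM_le _).trans (by gcongr; exact hA hr ht hrt)

theorem isLinearSolution_iff {T : ℝ} {A : Rn n → ℝ → Matrix (Fin n) (Fin n) ℝ}
    {x₀ q z : ℝ → Rn n} :
    IsLinearSolution T A x₀ q z ↔
      (z, q) ∈ linearSolutions (fun τ t => matCLM (A (x₀ τ) t)) 0 T := by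
  rw [IsLinearSolution, mem_linearSolutions]
  refine and_congr_right fun _ => forall₂_congr fun s hs => ⟨fun h => ?_, fun h => ⟨⟨_, h⟩, ?_⟩⟩
  · rw [← h.2, sub_sub_cancel]
    exact h.1.hasKurzweilIntegral
  · rw [h.kurzweilIntegral_eq hs.1, sub_sub_cancel]

end Matrix

section RegulatedBall

variable {E : Type*} [NormedAddCommGroup E] [NormedSpace ℝ E] {T : ℝ} {x₀ x : ℝ → E}

theorem closedBall_subset_of_regBall {Ω : Set E} {ρ τ : ℝ} (hρ : 0 ≤ ρ)
    (hx₀ : x₀ ∈ regulated 0 T E) (hball : ∀ x ∈ regBall T x₀ ρ, ∀ t ∈ Icc 0 T, x t ∈ Ω)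
    (hτ : τ ∈ Icc 0 T) : Metric.closedBall (x₀ τ) ρ ⊆ Ω := by
  intro y hy
  have hconst : (fun _ => y - x₀ τ) ∈ regulated 0 T E :=
    ⟨fun _ _ => ⟨_, tendsto_const_nhds⟩, fun _ _ => ⟨_, tendsto_const_nhds⟩⟩
  have hmem : (fun t => x₀ t + (y - x₀ τ)) ∈ regBall T x₀ ρ := by
    refine ⟨(regulatedSubmodule 0 T E).add_mem hx₀ hconst, Real.iSup_le (fun t => ?_) hρ⟩
    simpa only [add_sub_cancel_left] using mem_closedBall_iff_norm.1 hy
  simpa only [add_sub_cancel] using hball _ hmem τ hτ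

theorem norm_sub_le_supNorm (hx : x ∈ regulated 0 T E) (hx₀ : x₀ ∈ regulated 0 T E) {t : ℝ}
    (ht : t ∈ Icc 0 T) : ‖x t - x₀ t‖ ≤ supNorm T fun t => x t - x₀ t :=
  norm_le_supNorm ((regulatedSubmodule 0 T E).sub_mem hx hx₀) ht

/-- The rescaled difference `(x - x₀) / ‖x - x₀‖`, whose limits at a bifurcation point solve the
linearized equation; it is `0` when `x = x₀` on `[0, T]`. -/
noncomputable def normalizedDiff (T : ℝ) (x₀ x : ℝ → E) (t : ℝ) : E :=
  (supNorm T fun t => x t - x₀ t)⁻¹ • (x t - x₀ t)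

theorem norm_normalizedDiff (T : ℝ) (x₀ x : ℝ → E) (t : ℝ) :
    ‖normalizedDiff T x₀ x t‖ = ‖x t - x₀ t‖ / supNorm T fun t => x t - x₀ t := by
  rw [normalizedDiff, norm_smul, norm_inv, inv_mul_eq_div,
    Real.norm_of_nonneg (supNorm_nonneg _ _)]

theorem norm_normalizedDiff_le_one (hx : x ∈ regulated 0 T E) (hx₀ : x₀ ∈ regulated 0 T E)
    {t : ℝ} (ht : t ∈ Icc 0 T) : ‖normalizedDiff T x₀ x t‖ ≤ 1 := by
  rw [norm_normalizedDiff]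
  exact div_le_one_of_le₀ (norm_sub_le_supNorm hx hx₀ ht) (supNorm_nonneg _ _)

theorem exists_half_lt_norm_normalizedDiff (hpos : 0 < supNorm T fun t => x t - x₀ t) :
    ∃ t ∈ Icc 0 T, 1 / 2 < ‖normalizedDiff T x₀ x t‖ := by
  obtain ⟨t, ht, hlt⟩ := exists_lt_norm_of_lt_supNorm (half_pos hpos).le (half_lt_self hpos)
  refine ⟨t, ht, ?_⟩
  rwa [norm_normalizedDiff, lt_div_iff₀ hpos, one_div_mul_eq_div]

end RegulatedBall

section Bifurcation

variable {n : ℕ} {T : ℝ} {Λ : Set ℝ} {Ω : Set (Rn n)} {F : ℝ → Rn n → ℝ → Rn n}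
  {DF : ℝ → Rn n → ℝ → Matrix (Fin n) (Fin n) ℝ} {x₀ : ℝ → Rn n} {ρ lam₀ : ℝ}

theorem IsOperatorSolution.hasKurzweilIntegral_normalizedDiff {x : ℝ → Rn n} {lam : ℝ}
    (hx : IsOperatorSolution Λ T F x₀ ρ x lam) (hx₀ : IsPeriodicSolution Λ Ω T F x₀ lam) {s : ℝ}
    (hs : s ∈ Icc 0 T) :
    HasKurzweilIntegral
      (fun τ t => (supNorm T fun t => x t - x₀ t)⁻¹ • (F lam (x τ) t - F lam (x₀ τ) t)) 0 s
      (normalizedDiff T x₀ x s - normalizedDiff T x₀ x T) := by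
  obtain ⟨hint, heq⟩ := hx.2.2 s hs
  obtain ⟨-, hint₀, heq₀⟩ := hx₀.2.2.1 s hs
  rw [Phi] at heq
  rw [hx₀.2.2.2] at heq₀
  rw [normalizedDiff, normalizedDiff, ← smul_sub, sub_sub_sub_comm, sub_eq_of_eq_add' heq,
    sub_eq_of_eq_add' heq₀]
  exact (hint.hasKurzweilIntegral.sub hint₀.hasKurzweilIntegral).const_smul _

theorem IsBifurcationPoint.exists_seq (hbif : IsBifurcationPoint Λ T F ρ x₀ lam₀) :
    ∃ (x : ℕ → ℝ → Rn n) (lam : ℕ → ℝ), (∀ k, IsOperatorSolution Λ T F x₀ ρ (x k) (lam k)) ∧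
      (∀ k, 0 < supNorm T fun t => x k t - x₀ t) ∧
      Tendsto (fun k => supNorm T fun t => x k t - x₀ t) atTop (𝓝 0) ∧
      Tendsto lam atTop (𝓝 lam₀) := by
  choose x lam hsol hsup hlam hne using fun k : ℕ => hbif.2 (1 / ((k : ℝ) + 1)) (by positivity)
  have hpos : ∀ k, 0 < supNorm T fun t => x k t - x₀ t := fun k => by
    obtain ⟨t, ht, hxt⟩ := hne k
    exact (norm_pos_iff.2 (sub_ne_zero.2 hxt)).trans_le
      (norm_sub_le_supNorm (hsol k).1.1 hbif.1.1.1 ht)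
  refine ⟨x, lam, hsol, hpos, squeeze_zero (fun k => (hpos k).le) (fun k => (hsup k).le)
    tendsto_one_div_add_atTop_nhds_zero_nat, tendsto_iff_dist_tendsto_zero.2 (squeeze_zero
    (fun _ => dist_nonneg) (fun k => (hlam k).le) tendsto_one_div_add_atTop_nhds_zero_nat)⟩

theorem IsOperatorSolution.incrementsLE_linearization {x : ℝ → Rn n} {lam τ : ℝ} {g : ℝ → ℝ}
    (hx : IsOperatorSolution Λ T F x₀ ρ x lam) (hx₀ : x₀ ∈ regulated 0 T (Rn n))
    (hball : ∀ x ∈ regBall T x₀ ρ, ∀ t ∈ Icc 0 T, x t ∈ Ω)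
    (hder : ∀ w ∈ Ω, ∀ t ∈ Icc 0 T, HasFDerivAt (fun y => F lam y t) (matCLM (DF lam w t)) w)
    (hpos : 0 < supNorm T fun t => x t - x₀ t) (hτ : τ ∈ Icc 0 T)
    (hDF : ∀ w ∈ Ω, ‖w - x₀ τ‖ ≤ supNorm T (fun t => x t - x₀ t) →
      IncrementsLE (fun t => DF lam w t - DF lam₀ (x₀ τ) t) g (Icc 0 T)) :
    IncrementsLE
      (fun t => (supNorm T fun t => x t - x₀ t)⁻¹ • (F lam (x τ) t - F lam (x₀ τ) t) -
        matCLM (DF lam₀ (x₀ τ) t) (normalizedDiff T x₀ x τ))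
      (fun t => n * g t) (Icc 0 T) := by
  have hΩ : Metric.closedBall (x₀ τ) (supNorm T fun t => x t - x₀ t) ⊆ Ω :=
    (Metric.closedBall_subset_closedBall hx.1.2).trans
      (closedBall_subset_of_regBall (hpos.le.trans hx.1.2) hx₀ hball hτ)
  refine incrementsLE_smul_sub_sub_apply_of_hasFDerivAt hpos
    (fun w hw => hder w (hΩ hw)) (fun w hw => ?_) (norm_sub_le_supNorm hx.1.1 hx₀ hτ)
  simpa only [matCLM_sub] using (hDF w (hΩ hw) (mem_closedBall_iff_norm.1 hw)).matCLM

theorem IsBifurcationPoint.exists_isLinearSolution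
    (hx₀ : ∀ lam ∈ Λ, IsPeriodicSolution Λ Ω T F x₀ lam)
    (hball : ∀ x ∈ regBall T x₀ ρ, ∀ t ∈ Icc 0 T, x t ∈ Ω)
    (hDF : DerivCondition Λ Ω T F DF) (hDFparam : ParamCondition Λ Ω T DF)
    (hbif : IsBifurcationPoint Λ T F ρ x₀ lam₀) :
    ∃ z, IsLinearSolution T (DF lam₀) x₀ 0 z ∧ ∃ t ∈ Icc 0 T, z t ≠ 0 := by
  obtain ⟨hder, -, h, ω, hh, -, hω, hcl⟩ := hDF
  obtain ⟨g, hg, hcont⟩ := exists_incrementsLE_of_mem_classF hh hω hcl hDFparam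
  obtain ⟨x, lam, hx, hpos, hsup, hlam⟩ := hbif.exists_seq
  have hreg := hbif.1.1.1
  have hlam₀ := hbif.1.2.1
  have hx₀Ω : ∀ τ ∈ Icc 0 T, x₀ τ ∈ Ω := fun τ hτ => ((hx₀ lam₀ hlam₀).2.2.1 τ hτ).1
  obtain ⟨z, hz, hzlim⟩ := exists_mem_linearSolutions_tendstoUniformlyOn (hyperfilter ℕ)
    (fun τ hτ => (hg lam₀ hlam₀ _ (hx₀Ω τ hτ)).matCLM)
    (fun k t ht => norm_normalizedDiff_le_one (hx k).1.1 hreg ht)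
    (fun k s hs => (hx k).hasKurzweilIntegral_normalizedDiff (hx₀ _ (hx k).2.1) hs)
    fun ε hε => by
      obtain ⟨δ, hδ, hcont⟩ := hcont ε hε
      filter_upwards [Nat.hyperfilter_le_atTop (hsup.eventually (gt_mem_nhds hδ)),
        Nat.hyperfilter_le_atTop (Metric.tendsto_nhds.1 hlam δ hδ)] with k hk hlk τ hτ
      simpa only [mul_left_comm ε] using (hx k).incrementsLE_linearization hreg hball
        (hder _ (hx k).2.1) (hpos k) hτ fun w hw hwx => hcont _ (hx k).2.1 _ hlam₀ w hw _
          (hx₀Ω τ hτ) hlk (hwx.trans_lt hk)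
  obtain ⟨k, hk⟩ := (Metric.tendstoUniformlyOn_iff.1 hzlim (1 / 2) one_half_pos).exists
  obtain ⟨t, ht, hlt⟩ := exists_half_lt_norm_normalizedDiff (hpos k)
  refine ⟨z, isLinearSolution_iff.2 hz, t, ht, fun hzt => hlt.not_gt ?_⟩
  simpa only [hzt, dist_zero_left] using hk t ht

end Bifurcation

theorem mainTheorem1_general {n : ℕ} (T : ℝ) (Λ : Set ℝ) (Ω : Set (Rn n))
    (F : ℝ → Rn n → ℝ → Rn n) (DF : ℝ → Rn n → ℝ → Matrix (Fin n) (Fin n) ℝ)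
    (x₀ : ℝ → Rn n) (ρ : ℝ)
    (hx₀ : ∀ lam ∈ Λ, IsPeriodicSolution Λ Ω T F x₀ lam)
    (hball : ∀ x ∈ regBall T x₀ ρ, ∀ t ∈ Icc 0 T, x t ∈ Ω)
    (hDF : DerivCondition Λ Ω T F DF)
    (hDFparam : ParamCondition Λ Ω T DF)
    (lam₀ : ℝ) (hbif : IsBifurcationPoint Λ T F ρ x₀ lam₀) :
    (∃ q ∈ regulated 0 T (Rn n), ¬ ∃ z, IsLinearSolution T (DF lam₀) x₀ q z) ∧
    (∃ z, IsLinearSolution T (DF lam₀) x₀ (fun _ => 0) z ∧ ∃ t ∈ Icc 0 T, z t ≠ 0) := by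
  obtain ⟨z, hz, t, ht, hzt⟩ := hbif.exists_isLinearSolution hx₀ hball hDF hDFparam
  refine ⟨?_, z, hz, t, ht, hzt⟩
  obtain ⟨-, -, h, ω, hh, -, -, hcl⟩ := hDF
  have hlam₀ := hbif.1.2.1
  have hL : ∀ τ ∈ Icc 0 T, IncrementsLE (fun t => matCLM (DF lam₀ (x₀ τ) t)) (fun t => n * h t)
      (Icc 0 T) := fun τ hτ =>
    (IncrementsLE.of_mem_classF hh (hcl lam₀ hlam₀) ((hx₀ lam₀ hlam₀).2.2.1 τ hτ).1).matCLM
  obtain ⟨q, hq, hno⟩ := exists_forall_notMem_linearSolutions hL (isLinearSolution_iff.1 hz) ht hzt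
  exact ⟨q, hq, fun ⟨w, hw⟩ => hno w (isLinearSolution_iff.1 hw)⟩

theorem mainTheorem1 {n : ℕ} (T : ℝ) (hT : 0 < T)
    (Λ : Set ℝ) (hΛ : IsOpen Λ) (Ω : Set (Rn n)) (hΩ : IsOpen Ω)
    (F : ℝ → Rn n → ℝ → Rn n) (DF : ℝ → Rn n → ℝ → Matrix (Fin n) (Fin n) ℝ)
    (x₀ : ℝ → Rn n) (ρ : ℝ) (hρ : 0 < ρ)
    (hF : FieldCondition Λ Ω T F)
    (hx₀ : ∀ lam ∈ Λ, IsPeriodicSolution Λ Ω T F x₀ lam)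
    (hball : ∀ x ∈ regBall T x₀ ρ, ∀ t ∈ Icc 0 T, x t ∈ Ω)
    (hFparam : ParamCondition Λ Ω T F)
    (hDF : DerivCondition Λ Ω T F DF)
    (hDFparam : ParamCondition Λ Ω T DF)
    (lam₀ : ℝ) (hlam₀ : lam₀ ∈ Λ)
    (hbif : IsBifurcationPoint Λ T F ρ x₀ lam₀) :
    (∃ q ∈ regulated 0 T (Rn n), ¬ ∃ z, IsLinearSolution T (DF lam₀) x₀ q z) ∧
    (∃ z, IsLinearSolution T (DF lam₀) x₀ (fun _ => 0) z ∧ ∃ t ∈ Icc 0 T, z t ≠ 0) :=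
  mainTheorem1_general T Λ Ω F DF x₀ ρ hx₀ hball hDF hDFparam lam₀ hbif
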